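/- Theorem 4.1. Let $n\ge 2$, $\mathcal N=\{1,\dots,n\}$ and let $A=[a_{i,j}]\in\mathbb C^{n\times n}$. Definitions. $A\in GDD$ ($A$ is generalized diagonally dominant) means that there is a diagonal matrix $X=\mathrm{diag}(x_1,\dots,x_n)$ with all $x_i>0$ such that $X^{-1}AX$ is strictly diagonally dominant by rows, i.e. $|a_{i,i}|>\frac1{x_i}\sum_{j\ne i}|a_{i,j}|x_j$ for all $i\in\mathcal N$. A $G$-function is a map $f=(f_1,\dots,f_n)$ from $\mathbb C^{n\times n}$ to the vectors of $\mathbb R^n$ with nonnegative entries such that (i) each $f_k(B)$ depends only on the moduli of the off-diagonal entries of $B$, and (ii) every $B=[b_{i,j}]\in\mathbb C^{n\times n}$ with $|b_{i,i}|>f_i(B)$ for all $i\in\mathcal N$ is nonsingular. $\mathcal G_n$ is the set of all $G$-functions. Powers use the conventions $0^0=1$ and $0^t=0$ for $t>0$. Statement. For each one of the nineteen conditions (1)-(19) below, the following equivalence holds: $A\in GDD$ if and only if there exist $g,h\in\mathcal G_n$ and $\alpha,\beta\in[0,1]$ such that this condition holds for all $i,j\in\mathcal N$ with $i\ne j$.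 (The parameters $g,h,\alpha,\beta$ may be different for different conditions. Below, $g_i$ and $h_i$ stand for $g_i(A)$ and $h_i(A)$.) - (1) $|a_{i,i}| > g_i$; - (2) $|a_{i,i}| > g_i^{\alpha}h_i^{1-\alpha}$; - (3) $|a_{i,i}| > \alpha g_i+(1-\alpha)h_i$; - (4) $|a_{i,i}||a_{j,j}| > g_i g_j$; - (5) $|a_{i,i}||a_{j,j}| > g_i h_j$; - (6) $|a_{i,i}||a_{j,j}| > (g_ig_j)^{\alpha}(h_ih_j)^{1-\alpha}$; - (7) $|a_{i,i}||a_{j,j}| > (g_ih_j)^{\alpha}(g_jh_i)^{1-\alpha}$; - (8) $|a_{i,i}||a_{j,j}| > \alpha g_ig_j+(1-\alpha)h_ih_j$; - (9) $|a_{i,i}||a_{j,j}| > \alpha g_ih_j+(1-\alpha)g_jh_i$; - (10) $|a_{i,i}||a_{j,j}| > [\alpha g_i+(1-\alpha)h_i][\alpha g_j+(1-\alpha)h_j]$; - (11) $|a_{i,i}||a_{j,j}| > [\alpha g_i+(1-\alpha)h_i][\alpha h_j+(1-\alpha)g_j]$; - (12) $|a_{i,i}|^{\alpha}|a_{j,j}|^{1-\alpha}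 > g_i^{\alpha}g_j^{1-\alpha}$; - (13) $|a_{i,i}|^{\alpha}|a_{j,j}|^{1-\alpha} > g_i^{\alpha}h_j^{1-\alpha}$; - (14) $|a_{i,i}|^{\alpha}|a_{j,j}|^{1-\alpha} > [g_i^{\beta}h_i^{1-\beta}]^{\alpha}[g_j^{\beta}h_j^{1-\beta}]^{1-\alpha}$; - (15) $|a_{i,i}|^{\alpha}|a_{j,j}|^{1-\alpha} > [g_i^{\beta}h_i^{1-\beta}]^{\alpha}[h_j^{\beta}g_j^{1-\beta}]^{1-\alpha}$; - (16) $|a_{i,i}|^{\alpha}|a_{j,j}|^{1-\alpha} > \beta g_i^{\alpha}g_j^{1-\alpha}+(1-\beta)h_i^{\alpha}h_j^{1-\alpha}$; - (17) $|a_{i,i}|^{\alpha}|a_{j,j}|^{1-\alpha} > \beta g_i^{\alpha}h_j^{1-\alpha}+(1-\beta)h_i^{\alpha}g_j^{1-\alpha}$; - (18) $|a_{i,i}|^{\alpha}|a_{j,j}|^{1-\alpha} > [\beta g_i+(1-\beta)h_i]^{\alpha}[\beta g_j+(1-\beta)h_j]^{1-\alpha}$; - (19) $|a_{i,i}|^{\alpha}|a_{j,j}|^{1-\alpha}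 > [\beta g_i+(1-\beta)h_i]^{\alpha}[\beta h_j+(1-\beta)g_j]^{1-\alpha}$. -/

import Mathlib

namespace GFun

/-- The `i`-th deleted absolute row sum `r_i(A)`: the sum of `|a_{i,j}|` over `j ≠ i`. -/
noncomputable def rowSum {n : ℕ} (A : Matrix (Fin n) (Fin n) ℂ) (i : Fin n) : ℝ :=
  ∑ j ∈ Finset.univ.erase i, ‖A i j‖

/-- Strict diagonal dominance by rows. -/
def IsSDD {n : ℕ} (A : Matrix (Fin n) (Fin n) ℂ) : Prop :=
  ∀ i, rowSum A i < ‖A i i‖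

/-- Generalized diagonal dominance by rows: `X⁻¹ A X` is strictly diagonally dominant for some
diagonal matrix `X = diag(x)` with positive diagonal entries. -/
def IsGDD {n : ℕ} (A : Matrix (Fin n) (Fin n) ℂ) : Prop :=
  ∃ x : Fin n → ℝ, (∀ i, 0 < x i) ∧
    IsSDD ((Matrix.diagonal fun i => (x i : ℂ))⁻¹ * A * Matrix.diagonal fun i => (x i : ℂ))

/-- The class `𝓕ₙ`: functions `f` from complex `n × n` matrices to vectors with nonnegative
entries, such that `f_k(A)` depends only on the moduli of the off-diagonal entries of `A`. -/
def classF (n : ℕ) : Set (Matrix (Fin n) (Fin n) ℂ → Fin n → ℝ) :=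
  {f | (∀ A k, 0 ≤ f A k) ∧
    ∀ k, ∀ A B : Matrix (Fin n) (Fin n) ℂ,
      (∀ i j, i ≠ j → ‖A i j‖ = ‖B i j‖) → f A k = f B k}

/-- The class `𝓖ₙ` of `G`-functions: those `f ∈ 𝓕ₙ` for which `|a_{i,i}| > f_i(A)` for all `i`
implies that `A` is nonsingular. -/
def classG (n : ℕ) : Set (Matrix (Fin n) (Fin n) ℂ → Fin n → ℝ) :=
  {f | f ∈ classF n ∧
    ∀ A : Matrix (Fin n) (Fin n) ℂ, (∀ i, f A i < ‖A i i‖) → IsUnit A}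

/-- The nineteen inequalities for a pair of indices `i, j`, in order, where `d` stands for the
vector of the moduli of the diagonal entries and `g`, `h` stand for the vectors `g(A)`, `h(A)`.
Powers of nonnegative reals have `0 ^ 0 = 1` and `0 ^ t = 0` for `t > 0`. -/
noncomputable def inequalities {n : ℕ} (d g h : Fin n → ℝ) (α β : ℝ) (i j : Fin n) :
    Fin 19 → Prop :=
  ![d i > g i,
    d i > g i ^ α * h i ^ (1 - α),
    d i > α * g i + (1 - α) * h i,
    d i * d j > g i * g j,
    d i * d j > g i * h j,
    d i * d j > (g i * g j) ^ α * (h i * h j) ^ (1 - α),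
    d i * d j > (g i * h j) ^ α * (g j * h i) ^ (1 - α),
    d i * d j > α * (g i * g j) + (1 - α) * (h i * h j),
    d i * d j > α * (g i * h j) + (1 - α) * (g j * h i),
    d i * d j > (α * g i + (1 - α) * h i) * (α * g j + (1 - α) * h j),
    d i * d j > (α * g i + (1 - α) * h i) * (α * h j + (1 - α) * g j),
    d i ^ α * d j ^ (1 - α) > g i ^ α * g j ^ (1 - α),
    d i ^ α * d j ^ (1 - α) > g i ^ α * h j ^ (1 - α),
    d i ^ α * d j ^ (1 - α) >
      (g i ^ β * h i ^ (1 - β)) ^ α * (g j ^ β * h j ^ (1 - β)) ^ (1 - α),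
    d i ^ α * d j ^ (1 - α) >
      (g i ^ β * h i ^ (1 - β)) ^ α * (h j ^ β * g j ^ (1 - β)) ^ (1 - α),
    d i ^ α * d j ^ (1 - α) >
      β * (g i ^ α * g j ^ (1 - α)) + (1 - β) * (h i ^ α * h j ^ (1 - α)),
    d i ^ α * d j ^ (1 - α) >
      β * (g i ^ α * h j ^ (1 - α)) + (1 - β) * (h i ^ α * g j ^ (1 - α)),
    d i ^ α * d j ^ (1 - α) >
      (β * g i + (1 - β) * h i) ^ α * (β * g j + (1 - β) * h j) ^ (1 - α),
    d i ^ α * d j ^ (1 - α) >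
      (β * g i + (1 - β) * h i) ^ α * (β * h j + (1 - β) * g j) ^ (1 - α)]

end GFun

namespace GFun

open Finset Matrix

variable {n : ℕ}

/-! If A is generalized diagonally dominant with weights x, its x-weighted row sums form a
G-function, and g = h, α = β = 1 settles every condition.

For the converse, a value g(A) of a G-function, increased by any ε > 0, is a dominating diagonal for
the off-diagonal moduli of A (`classG_apply_mem_nearlyDominatingDiag`, an M-matrix continuity
argument). Such nearly dominating vectors are closed under weighted geometric means by Hölder, hence
under arithmetic means by AM-GM and monotonicity. Every condition thus compares the diagonal with
one or two nearly dominating vectors. Multiplying the inequalities for (i, j) and (j, i) merges two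
vectors into one, and the Brauer-type criterion `mem_dominatingDiag_of_mul_le_mul` finishes. -/

/-- The vectors `d` such that every matrix with diagonal moduli `d` and the off-diagonal moduli of
`A` is generalized diagonally dominant. -/
def dominatingDiag (A : Matrix (Fin n) (Fin n) ℂ) : Set (Fin n → ℝ) :=
  {d | ∃ x : Fin n → ℝ, (∀ i, 0 < x i) ∧
    ∀ i, ∑ j ∈ univ.erase i, ‖A i j‖ * x j < d i * x i}

/-- Nonnegative vectors all of whose positive uniform shifts lie in `dominatingDiag A`. -/
def nearlyDominatingDiag (A : Matrix (Fin n) (Fin n) ℂ) : Set (Fin n → ℝ) :=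
  {f | (∀ i, 0 ≤ f i) ∧ ∀ ε > 0, (fun i => f i + ε) ∈ dominatingDiag A}

/-! ### Weighted row sums as G-functions -/

/-- The absolute row sums of `A` weighted by a positive vector `x`. -/
noncomputable def weightedRowSum (x : Fin n → ℝ) (A : Matrix (Fin n) (Fin n) ℂ) (i : Fin n) : ℝ :=
  (x i)⁻¹ * ∑ j ∈ univ.erase i, ‖A i j‖ * x j

lemma weightedRowSum_nonneg {x : Fin n → ℝ} (hx : ∀ i, 0 < x i)
    (A : Matrix (Fin n) (Fin n) ℂ) (i : Fin n) : 0 ≤ weightedRowSum x A i :=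
  mul_nonneg (inv_nonneg.2 (hx i).le)
    (sum_nonneg fun j _ => mul_nonneg (norm_nonneg _) (hx j).le)

lemma weightedRowSum_lt_iff {x : Fin n → ℝ} (hx : ∀ i, 0 < x i)
    (A : Matrix (Fin n) (Fin n) ℂ) (i : Fin n) (c : ℝ) :
    weightedRowSum x A i < c ↔ ∑ j ∈ univ.erase i, ‖A i j‖ * x j < c * x i := by
  rw [weightedRowSum, inv_mul_lt_iff₀ (hx i), mul_comm (x i)]

/-- Lévy–Desplanques applied to A · diag(x). -/
lemma isUnit_of_weightedRowSum_lt {x : Fin n → ℝ} (hx : ∀ i, 0 < x i)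
    {A : Matrix (Fin n) (Fin n) ℂ} (h : ∀ i, weightedRowSum x A i < ‖A i i‖) : IsUnit A := by
  have key : (A * diagonal fun i => (x i : ℂ)).det ≠ 0 := by
    apply det_ne_zero_of_sum_row_lt_diag
    intro i
    have := (weightedRowSum_lt_iff hx A i _).1 (h i)
    simpa [mul_diagonal, abs_of_pos (hx _)] using this
  rw [det_mul] at key
  exact (isUnit_iff_isUnit_det A).2 (isUnit_iff_ne_zero.2 (left_ne_zero_of_mul key))

lemma weightedRowSum_mem_classG {x : Fin n → ℝ} (hx : ∀ i, 0 < x i) :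
    weightedRowSum x ∈ classG n := by
  refine ⟨⟨weightedRowSum_nonneg hx, fun k A B h => ?_⟩,
    fun A h => isUnit_of_weightedRowSum_lt hx h⟩
  unfold weightedRowSum
  congr 1
  exact sum_congr rfl fun j hj => by rw [h k j (ne_of_mem_erase hj).symm]

lemma isSDD_conj_diagonal_iff {x : Fin n → ℝ} (hx : ∀ i, 0 < x i)
    (A : Matrix (Fin n) (Fin n) ℂ) :
    IsSDD ((diagonal fun i => (x i : ℂ))⁻¹ * A * diagonal fun i => (x i : ℂ)) ↔
      ∀ i, weightedRowSum x A i < ‖A i i‖ := by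
  have hinv : (diagonal fun i => (x i : ℂ))⁻¹ = diagonal fun i => ((x i : ℂ))⁻¹ := by
    apply inv_eq_left_inv
    rw [diagonal_mul_diagonal, ← diagonal_one]
    congr 1
    ext i
    exact inv_mul_cancel₀ (by exact_mod_cast (hx i).ne')
  rw [hinv]
  refine forall_congr' fun i => ?_
  have hi : ((x i : ℂ))⁻¹ * A i i * x i = A i i := by
    have : (x i : ℂ) ≠ 0 := by exact_mod_cast (hx i).ne'
    field_simp
  simp only [rowSum, weightedRowSum, mul_diagonal, diagonal_mul, hi, norm_mul, norm_inv,
    Complex.norm_real, Real.norm_of_nonneg (hx _).le, mul_sum, mul_assoc]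

lemma isGDD_iff_exists_weightedRowSum_lt {A : Matrix (Fin n) (Fin n) ℂ} :
    IsGDD A ↔ ∃ x : Fin n → ℝ, (∀ i, 0 < x i) ∧ ∀ i, weightedRowSum x A i < ‖A i i‖ :=
  exists_congr fun _ => and_congr_right fun hx => isSDD_conj_diagonal_iff hx A

lemma isGDD_iff_mem_dominatingDiag {A : Matrix (Fin n) (Fin n) ℂ} :
    IsGDD A ↔ (fun i => ‖A i i‖) ∈ dominatingDiag A := by
  rw [isGDD_iff_exists_weightedRowSum_lt]
  exact exists_congr fun x => and_congr_right fun hx =>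
    forall_congr' fun i => weightedRowSum_lt_iff hx A i _

lemma dominatingDiag_mono {A : Matrix (Fin n) (Fin n) ℂ} {d e : Fin n → ℝ}
    (hd : d ∈ dominatingDiag A) (h : ∀ i, d i ≤ e i) : e ∈ dominatingDiag A := by
  obtain ⟨x, hx, hs⟩ := hd
  exact ⟨x, hx, fun i => (hs i).trans_le (mul_le_mul_of_nonneg_right (h i) (hx i).le)⟩

lemma pos_of_mem_dominatingDiag {A : Matrix (Fin n) (Fin n) ℂ} {d : Fin n → ℝ}
    (hd : d ∈ dominatingDiag A) (i : Fin n) : 0 < d i := by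
  obtain ⟨x, hx, hs⟩ := hd
  exact pos_of_mul_pos_left ((sum_nonneg fun j _ =>
    mul_nonneg (norm_nonneg _) (hx j).le).trans_lt (hs i)) (hx i).le

/-! ### Closure under means -/

/-- A strict form of Hölder's inequality for weighted sums. -/
lemma sum_mul_rpow_mul_rpow_lt {ι : Type*} (s : Finset ι) {b x y : ι → ℝ} (hb : ∀ i, 0 ≤ b i)
    (hx : ∀ i, 0 < x i) (hy : ∀ i, 0 < y i) {P Q α : ℝ} (hα : α ∈ Set.Icc (0 : ℝ) 1)
    (hP : ∑ i ∈ s, b i * x i < P) (hQ : ∑ i ∈ s, b i * y i < Q) :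
    ∑ i ∈ s, b i * (x i ^ α * y i ^ (1 - α)) < P ^ α * Q ^ (1 - α) := by
  have hα' : 0 ≤ 1 - α := sub_nonneg.2 hα.2
  have hP0 : 0 < P := (sum_nonneg fun i _ => mul_nonneg (hb i) (hx i).le).trans_lt hP
  have hQ0 : 0 < Q := (sum_nonneg fun i _ => mul_nonneg (hb i) (hy i).le).trans_lt hQ
  have hPQ : 0 < P ^ α * Q ^ (1 - α) := by positivity
  have h1 : α * ((∑ i ∈ s, b i * x i) / P) + (1 - α) * ((∑ i ∈ s, b i * y i) / Q) < 1 :=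
    convex_Iio (1 : ℝ) ((div_lt_one hP0).2 hP) ((div_lt_one hQ0).2 hQ) hα.1 hα' (by ring)
  calc ∑ i ∈ s, b i * (x i ^ α * y i ^ (1 - α))
      = ∑ i ∈ s, P ^ α * Q ^ (1 - α) * (b i * ((x i / P) ^ α * (y i / Q) ^ (1 - α))) := by
        refine sum_congr rfl fun i _ => ?_
        rw [Real.div_rpow (hx i).le hP0.le, Real.div_rpow (hy i).le hQ0.le]
        field_simp
    _ ≤ ∑ i ∈ s, P ^ α * Q ^ (1 - α) * (b i * (α * (x i / P) + (1 - α) * (y i / Q))) := by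
        refine sum_le_sum fun i _ => mul_le_mul_of_nonneg_left
          (mul_le_mul_of_nonneg_left ?_ (hb i)) hPQ.le
        exact Real.geom_mean_le_arith_mean2_weighted hα.1 hα' (div_pos (hx i) hP0).le
          (div_pos (hy i) hQ0).le (by ring)
    _ = P ^ α * Q ^ (1 - α) *
          (α * ((∑ i ∈ s, b i * x i) / P) + (1 - α) * ((∑ i ∈ s, b i * y i) / Q)) := by
        simp only [sum_div, mul_sum, ← sum_add_distrib]
        exact sum_congr rfl fun i _ => by ring
    _ < P ^ α * Q ^ (1 - α) := mul_lt_of_lt_one_right hPQ h1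

/-- The weights are the same geometric mean of the two given weight vectors. -/
lemma geom_mean_mem_dominatingDiag {A : Matrix (Fin n) (Fin n) ℂ} {u v : Fin n → ℝ}
    (hu : u ∈ dominatingDiag A) (hv : v ∈ dominatingDiag A) {α : ℝ} (hα : α ∈ Set.Icc (0 : ℝ) 1) :
    (fun i => u i ^ α * v i ^ (1 - α)) ∈ dominatingDiag A := by
  have hu0 := pos_of_mem_dominatingDiag hu
  have hv0 := pos_of_mem_dominatingDiag hv
  obtain ⟨x, hx, hxs⟩ := hu
  obtain ⟨y, hy, hys⟩ := hv
  refine ⟨fun i => x i ^ α * y i ^ (1 - α), fun i =>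
    mul_pos (Real.rpow_pos_of_pos (hx i) _) (Real.rpow_pos_of_pos (hy i) _), fun i => ?_⟩
  refine (sum_mul_rpow_mul_rpow_lt _ (fun j => norm_nonneg (A i j)) hx hy hα
    (hxs i) (hys i)).trans_eq ?_
  rw [Real.mul_rpow (hu0 i).le (hx i).le, Real.mul_rpow (hv0 i).le (hy i).le]
  ring

lemma nearlyDominatingDiag_mono {A : Matrix (Fin n) (Fin n) ℂ} {f g : Fin n → ℝ}
    (hf : f ∈ nearlyDominatingDiag A) (h : ∀ i, f i ≤ g i) : g ∈ nearlyDominatingDiag A :=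
  ⟨fun i => (hf.1 i).trans (h i), fun ε hε =>
    dominatingDiag_mono (hf.2 ε hε) fun i => add_le_add_left (h i) ε⟩

-- Shifting u and v by a small δ moves the mean by less than ε, by continuity of the powers with
-- nonnegative exponents.
open Filter Topology in
lemma geom_mean_mem_nearlyDominatingDiag {A : Matrix (Fin n) (Fin n) ℂ} {u v : Fin n → ℝ}
    (hu : u ∈ nearlyDominatingDiag A) (hv : v ∈ nearlyDominatingDiag A) {α : ℝ}
    (hα : α ∈ Set.Icc (0 : ℝ) 1) :
    (fun i => u i ^ α * v i ^ (1 - α)) ∈ nearlyDominatingDiag A := by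
  have hα' : 0 ≤ 1 - α := sub_nonneg.2 hα.2
  refine ⟨fun i => mul_nonneg (Real.rpow_nonneg (hu.1 i) _) (Real.rpow_nonneg (hv.1 i) _),
    fun ε hε => ?_⟩
  have hev : ∀ᶠ δ in 𝓝[>] (0 : ℝ), ∀ i,
      (u i + δ) ^ α * (v i + δ) ^ (1 - α) < u i ^ α * v i ^ (1 - α) + ε := by
    refine eventually_all.2 fun i => ?_
    have hc : Continuous fun δ : ℝ => (u i + δ) ^ α * (v i + δ) ^ (1 - α) :=
      ((continuous_const.add continuous_id).rpow_const fun _ => Or.inr hα.1).mul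
        ((continuous_const.add continuous_id).rpow_const fun _ => Or.inr hα')
    have ht := hc.tendsto 0
    simp only [add_zero] at ht
    exact nhdsWithin_le_nhds (ht.eventually (gt_mem_nhds (lt_add_of_pos_right _ hε)))
  obtain ⟨δ, hδ, hδ0⟩ := (hev.and self_mem_nhdsWithin).exists
  exact dominatingDiag_mono (geom_mean_mem_dominatingDiag (hu.2 δ hδ0) (hv.2 δ hδ0) hα)
    fun i => (hδ i).le

lemma arith_mean_mem_nearlyDominatingDiag {A : Matrix (Fin n) (Fin n) ℂ} {u v : Fin n → ℝ}
    (hu : u ∈ nearlyDominatingDiag A) (hv : v ∈ nearlyDominatingDiag A) {α : ℝ}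
    (hα : α ∈ Set.Icc (0 : ℝ) 1) :
    (fun i => α * u i + (1 - α) * v i) ∈ nearlyDominatingDiag A :=
  nearlyDominatingDiag_mono (geom_mean_mem_nearlyDominatingDiag hu hv hα) fun i =>
    Real.geom_mean_le_arith_mean2_weighted hα.1 (sub_nonneg.2 hα.2) (hu.1 i) (hv.1 i) (by ring)

/-! ### G-functions and M-matrices -/

/-- If `D - s B` is nonsingular for all `s ∈ [0, 1]`, where `D` is a positive diagonal matrix and
`B` is entrywise nonnegative, then `(D - B) x` is positive for some positive vector `x`. -/
lemma exists_pos_mulVec_lt {ι : Type*} [Fintype ι] [DecidableEq ι] {w : ι → ℝ} (hw : ∀ i, 0 < w i)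
    {B : Matrix ι ι ℝ} (hB : ∀ i j, 0 ≤ B i j)
    (hdet : ∀ s ∈ Set.Icc (0 : ℝ) 1, (diagonal w - s • B).det ≠ 0) :
    ∃ x : ι → ℝ, (∀ i, 0 < x i) ∧ ∀ i, (B *ᵥ x) i < w i * x i := by
  let M : ℝ → Matrix ι ι ℝ := fun s => diagonal w - s • B
  -- x s is the solution of (D - sB) x = 1, written with the adjugate so that continuity in s is
  -- visible.
  let x : ℝ → ι → ℝ := fun s => (M s).det⁻¹ • ((M s).adjugate *ᵥ fun _ => 1)
  have hM : Continuous M := by fun_prop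
  have hxc : ContinuousOn x (Set.Icc 0 1) :=
    (hM.matrix_det.continuousOn.inv₀ hdet).smul
      (hM.matrix_adjugate.matrix_mulVec continuous_const).continuousOn
  have hx : ∀ s ∈ Set.Icc (0 : ℝ) 1, ∀ i, w i * x s i = 1 + s * (B *ᵥ x s) i := by
    intro s hs i
    have h : M s *ᵥ x s = fun _ => 1 := by
      simp only [x, mulVec_smul, mulVec_mulVec, mul_adjugate, smul_mulVec, one_mulVec, smul_smul]
      rw [inv_mul_cancel₀ (hdet s hs), one_smul]
    have := congrFun h i
    simp only [M, sub_mulVec, smul_mulVec, Pi.sub_apply, mulVec_diagonal, Pi.smul_apply,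
      smul_eq_mul] at this
    linarith
  -- A nonnegative solution is automatically positive, so along the path nonnegativity is both an
  -- open and a closed condition; it holds at s = 0, hence at s = 1.
  have hpos : ∀ s ∈ Set.Icc (0 : ℝ) 1, (∀ i, 0 ≤ x s i) → ∀ i, 0 < x s i := by
    intro s hs h i
    refine pos_of_mul_pos_right (a := w i) ?_ (hw i).le
    rw [hx s hs i]
    have : 0 ≤ (B *ᵥ x s) i := sum_nonneg fun j _ => mul_nonneg (hB i j) (h j)
    have := mul_nonneg hs.1 this
    linarith
  have hall : ∀ i, 0 ≤ x 1 i := by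
    have hcl : IsClosed {y : ι → ℝ | ∀ i, 0 ≤ y i} := by
      simp only [Set.ofPred_forall]
      exact isClosed_iInter fun i => isClosed_le continuous_const (continuous_apply i)
    have hop : IsOpen {y : ι → ℝ | ∀ i, 0 < y i} := by
      simp only [Set.ofPred_forall]
      exact isOpen_iInter_of_finite fun i => isOpen_lt continuous_const (continuous_apply i)
    have hconn : IsPreconnected (x '' Set.Icc 0 1) := isPreconnected_Icc.image _ hxc
    have h0 : ∀ i, 0 ≤ x 0 i := fun i => by
      have := hx 0 (by simp) i
      rw [zero_mul, add_zero] at this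
      exact (pos_of_mul_pos_right (this ▸ one_pos) (hw i).le).le
    have hsub : x '' Set.Icc 0 1 ⊆ {y : ι → ℝ | ∀ i, 0 < y i} :=
      hconn.subset_left_of_subset_union hop hcl.isOpen_compl
        (Set.disjoint_left.2 fun y hy hy' => hy' fun i => (hy i).le)
        (by
          rintro _ ⟨s, hs, rfl⟩
          by_cases h : ∀ i, 0 ≤ x s i
          · exact Or.inl (hpos s hs h)
          · exact Or.inr h)
        ⟨x 0, ⟨0, by simp, rfl⟩, hpos 0 (by simp) h0⟩
    exact fun i => (hsub ⟨1, by simp, rfl⟩ i).le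
  refine ⟨x 1, hpos 1 (by simp) hall, fun i => ?_⟩
  rw [hx 1 (by simp) i, one_mul]
  exact lt_one_add _

/-- The matrix of the moduli of the off-diagonal entries of `A`. -/
noncomputable def offDiagNorm (A : Matrix (Fin n) (Fin n) ℂ) : Matrix (Fin n) (Fin n) ℝ :=
  of fun i j => if i = j then 0 else ‖A i j‖

lemma classG_apply_mem_nearlyDominatingDiag {g : Matrix (Fin n) (Fin n) ℂ → Fin n → ℝ}
    (hg : g ∈ classG n) (A : Matrix (Fin n) (Fin n) ℂ) : g A ∈ nearlyDominatingDiag A := by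
  refine ⟨hg.1.1 A, fun ε hε => ?_⟩
  have hw : ∀ i, 0 < g A i + ε := fun i => add_pos_of_nonneg_of_pos (hg.1.1 A i) hε
  have hunit : ∀ t : ℝ, 1 ≤ t →
      (diagonal (fun i => t * (g A i + ε)) - offDiagNorm A).det ≠ 0 := by
    intro t ht
    -- C has the off-diagonal moduli of A, so g takes the same value on both, while its diagonal
    -- exceeds that value.
    let C : Matrix (Fin n) (Fin n) ℂ :=
      Complex.ofRealHom.mapMatrix (diagonal (fun i => t * (g A i + ε)) - offDiagNorm A)
    have hC : IsUnit C := by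
      apply hg.2
      intro i
      rw [hg.1.2 i C A fun k l hkl => by simp [C, offDiagNorm, hkl]]
      have h1 : ‖C i i‖ = t * (g A i + ε) := by
        have h0 : C i i = ((t * (g A i + ε) : ℝ) : ℂ) := by simp [C, offDiagNorm]
        rw [h0, Complex.norm_real, Real.norm_of_nonneg]
        exact mul_nonneg (by linarith) (hw i).le
      rw [h1]
      have := le_mul_of_one_le_left (hw i).le ht
      linarith
    have hd := ((isUnit_iff_isUnit_det C).1 hC).ne_zero
    rw [← RingHom.map_det] at hd
    exact fun h => hd (by rw [h, map_zero])
  obtain ⟨x, hx, hxs⟩ := exists_pos_mulVec_lt (B := offDiagNorm A) hw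
    (fun i j => by
      simp only [offDiagNorm, of_apply]
      split_ifs
      exacts [le_rfl, norm_nonneg _])
    (fun s hs => by
      -- For s > 0 the matrix is s times the one treated in `hunit` with t = 1/s ≥ 1.
      rcases hs.1.eq_or_lt with rfl | hs0
      · rw [zero_smul, sub_zero, det_diagonal]
        exact prod_ne_zero_iff.2 fun i _ => (hw i).ne'
      · have : diagonal (fun i => g A i + ε) - s • offDiagNorm A =
            s • (diagonal (fun i => s⁻¹ * (g A i + ε)) - offDiagNorm A) := by
          rw [smul_sub, ← diagonal_smul]
          congr 2
          ext i
          simp [hs0.ne']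
        rw [this, det_smul]
        exact mul_ne_zero (pow_ne_zero _ hs0.ne') (hunit _ ((one_le_inv₀ hs0).2 hs.2)))
  refine ⟨x, hx, fun i => (Eq.trans_lt ?_ (hxs i))⟩
  rw [mulVec, dotProduct, ← add_sum_erase univ _ (mem_univ i)]
  simp only [offDiagNorm, of_apply, if_true, zero_mul, zero_add]
  exact sum_congr rfl fun j hj => by rw [if_neg (ne_of_mem_erase hj).symm]

/-! ### Brauer-type criteria -/

/-- A Brauer-type criterion: strict domination of the products of pairs is enough. -/
lemma mem_dominatingDiag_of_mul_le_mul {A : Matrix (Fin n) (Fin n) ℂ} {w d : Fin n → ℝ}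
    (hw : w ∈ dominatingDiag A) (hd : ∀ i, 0 < d i)
    (h : ∀ i j, i ≠ j → w i * w j ≤ d i * d j) : d ∈ dominatingDiag A := by
  by_cases hall : ∀ i, w i ≤ d i
  · exact dominatingDiag_mono hw hall
  push Not at hall
  obtain ⟨p, hp⟩ := hall
  have hw0 := pos_of_mem_dominatingDiag hw
  obtain ⟨x, hx, hs⟩ := hw
  have ht : 1 < w p / d p := (one_lt_div (hd p)).2 hp
  have ht0 : 0 < w p / d p := one_pos.trans ht
  -- Enlarging x p by w p / d p makes row p read as before. Any other row sum grows at most by this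
  -- factor, which w i * w p ≤ d i * d p absorbs.
  refine ⟨Function.update x p (w p / d p * x p), fun i => ?_, fun i => ?_⟩
  · rcases eq_or_ne i p with rfl | hi
    · simpa using mul_pos ht0 (hx i)
    · simpa [hi] using hx i
  rcases eq_or_ne i p with rfl | hi
  · rw [Function.update_self, ← mul_assoc, mul_div_cancel₀ _ (hd i).ne']
    refine (sum_congr rfl fun j hj => ?_).trans_lt (hs i)
    rw [Function.update_of_ne (ne_of_mem_erase hj)]
  · rw [Function.update_of_ne hi]
    calc ∑ j ∈ univ.erase i, ‖A i j‖ * Function.update x p (w p / d p * x p) j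
        ≤ ∑ j ∈ univ.erase i, w p / d p * (‖A i j‖ * x j) := by
          refine sum_le_sum fun j _ => ?_
          rw [mul_left_comm]
          refine mul_le_mul_of_nonneg_left ?_ (norm_nonneg _)
          rcases eq_or_ne j p with rfl | hj
          · simp
          · rw [Function.update_of_ne hj]
            exact le_mul_of_one_le_left (hx j).le ht.le
      _ = w p / d p * ∑ j ∈ univ.erase i, ‖A i j‖ * x j := (mul_sum ..).symm
      _ < w p / d p * (w i * x i) := mul_lt_mul_of_pos_left (hs i) ht0
      _ = w i * w p / d p * x i := by ring
      _ ≤ d i * x i := mul_le_mul_of_nonneg_right ((div_le_iff₀ (hd p)).2 (h i p hi)) (hx i).le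

lemma exists_ne_of_two_le (hn : 2 ≤ n) (i : Fin n) : ∃ j, i ≠ j := by
  have : Nontrivial (Fin n) := Fin.nontrivial_iff_two_le.2 hn
  exact (exists_ne i).imp fun _ => Ne.symm

open Filter Topology in
lemma isGDD_of_mul_lt_mul_self (hn : 2 ≤ n) {A : Matrix (Fin n) (Fin n) ℂ} {f : Fin n → ℝ}
    (hf : f ∈ nearlyDominatingDiag A)
    (h : ∀ i j, i ≠ j → f i * f j < ‖A i i‖ * ‖A j j‖) : IsGDD A := by
  have hev : ∀ᶠ ε in 𝓝[>] (0 : ℝ), ∀ i j, i ≠ j →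
      (f i + ε) * (f j + ε) < ‖A i i‖ * ‖A j j‖ := by
    refine eventually_all.2 fun i => eventually_all.2 fun j => eventually_imp_distrib_left.2
      fun hij => ?_
    have hc : Continuous fun ε : ℝ => (f i + ε) * (f j + ε) := by fun_prop
    have ht := hc.tendsto 0
    simp only [add_zero] at ht
    exact nhdsWithin_le_nhds (ht.eventually (gt_mem_nhds (h i j hij)))
  obtain ⟨ε, hε, hε0⟩ := (hev.and self_mem_nhdsWithin).exists
  refine isGDD_iff_mem_dominatingDiag.2 (mem_dominatingDiag_of_mul_le_mul (hf.2 ε hε0)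
    (fun i => ?_) fun i j hij => (hε i j hij).le)
  obtain ⟨j, hij⟩ := exists_ne_of_two_le hn i
  exact pos_of_mul_pos_left ((mul_nonneg (hf.1 i) (hf.1 j)).trans_lt (h i j hij)) (norm_nonneg _)

lemma isGDD_of_lt (hn : 2 ≤ n) {A : Matrix (Fin n) (Fin n) ℂ} {f : Fin n → ℝ}
    (hf : f ∈ nearlyDominatingDiag A) (h : ∀ i j, i ≠ j → f i < ‖A i i‖) : IsGDD A :=
  isGDD_of_mul_lt_mul_self hn hf fun i j hij =>
    mul_lt_mul'' (h i j hij) (h j i hij.symm) (hf.1 i) (hf.1 j)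

/-- The product of the inequalities for (i, j) and (j, i) regroups into the product criterion for
the single vector u^α v^(1-α). -/
lemma isGDD_of_rpow_mul_rpow_lt (hn : 2 ≤ n) {A : Matrix (Fin n) (Fin n) ℂ} {u v : Fin n → ℝ}
    (hu : u ∈ nearlyDominatingDiag A) (hv : v ∈ nearlyDominatingDiag A) {α : ℝ}
    (hα : α ∈ Set.Icc (0 : ℝ) 1)
    (h : ∀ i j, i ≠ j → u i ^ α * v j ^ (1 - α) < ‖A i i‖ ^ α * ‖A j j‖ ^ (1 - α)) :
    IsGDD A := by
  refine isGDD_of_mul_lt_mul_self hn (geom_mean_mem_nearlyDominatingDiag hu hv hα)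
    fun i j hij => ?_
  have hpow : ∀ c : ℝ, 0 ≤ c → c ^ α * c ^ (1 - α) = c := fun c hc => by
    rw [← Real.rpow_add_of_nonneg hc hα.1 (sub_nonneg.2 hα.2), add_sub_cancel, Real.rpow_one]
  have hnn : ∀ i j, 0 ≤ u i ^ α * v j ^ (1 - α) := fun i j =>
    mul_nonneg (Real.rpow_nonneg (hu.1 i) _) (Real.rpow_nonneg (hv.1 j) _)
  have := mul_lt_mul'' (h i j hij) (h j i hij.symm) (hnn i j) (hnn j i)
  calc u i ^ α * v i ^ (1 - α) * (u j ^ α * v j ^ (1 - α))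
      = u i ^ α * v j ^ (1 - α) * (u j ^ α * v i ^ (1 - α)) := by ring
    _ < _ := this
    _ = ‖A i i‖ ^ α * ‖A i i‖ ^ (1 - α) * (‖A j j‖ ^ α * ‖A j j‖ ^ (1 - α)) := by ring
    _ = ‖A i i‖ * ‖A j j‖ := by rw [hpow _ (norm_nonneg _), hpow _ (norm_nonneg _)]

/-- Taking square roots gives the case α = 1/2 of the previous criterion. -/
lemma isGDD_of_mul_lt_mul (hn : 2 ≤ n) {A : Matrix (Fin n) (Fin n) ℂ} {u v : Fin n → ℝ}
    (hu : u ∈ nearlyDominatingDiag A) (hv : v ∈ nearlyDominatingDiag A)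
    (h : ∀ i j, i ≠ j → u i * v j < ‖A i i‖ * ‖A j j‖) : IsGDD A := by
  refine isGDD_of_rpow_mul_rpow_lt hn hu hv (α := 1 / 2) (by norm_num) fun i j hij => ?_
  rw [show (1 : ℝ) - 1 / 2 = 1 / 2 by norm_num, ← Real.mul_rpow (hu.1 i) (hv.1 j),
    ← Real.mul_rpow (norm_nonneg _) (norm_nonneg _)]
  exact Real.rpow_lt_rpow (mul_nonneg (hu.1 i) (hv.1 j)) (h i j hij) (by norm_num)

/-! ### The nineteen conditions -/

lemma mul_rpow_mul_mul_rpow {a b c d : ℝ} (ha : 0 ≤ a) (hb : 0 ≤ b) (hc : 0 ≤ c) (hd : 0 ≤ d)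
    (s t : ℝ) : (a * b) ^ s * (c * d) ^ t = a ^ s * c ^ t * (b ^ s * d ^ t) := by
  rw [Real.mul_rpow ha hb, Real.mul_rpow hc hd, mul_mul_mul_comm]

lemma rpow_mul_rpow_rpow_comm {a b c d : ℝ} (ha : 0 ≤ a) (hb : 0 ≤ b) (hc : 0 ≤ c) (hd : 0 ≤ d)
    (s t p q : ℝ) : (a ^ p * c ^ q) ^ s * (b ^ p * d ^ q) ^ t =
      (a ^ s * b ^ t) ^ p * (c ^ s * d ^ t) ^ q := by
  have h : ∀ x : ℝ, 0 ≤ x → ∀ y z : ℝ, (x ^ y) ^ z = (x ^ z) ^ y := fun x hx y z => by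
    rw [← Real.rpow_mul hx, ← Real.rpow_mul hx, mul_comm]
  have nn : ∀ {x : ℝ} (y : ℝ), 0 ≤ x → 0 ≤ x ^ y := fun y hx => Real.rpow_nonneg hx y
  rw [Real.mul_rpow (nn p ha) (nn q hc), Real.mul_rpow (nn p hb) (nn q hd),
    Real.mul_rpow (nn s ha) (nn t hb), Real.mul_rpow (nn s hc) (nn t hd),
    h a ha p s, h b hb p t, h c hc q s, h d hd q t, mul_mul_mul_comm]

lemma inequalities_self_one {d g : Fin n → ℝ} (hg : ∀ i, 0 ≤ g i) (h : ∀ i, g i < d i)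
    (i j : Fin n) (k : Fin 19) : inequalities d g g 1 1 i j k := by
  have hm : g i * g j < d i * d j := mul_lt_mul'' (h i) (h j) (hg i) (hg j)
  fin_cases k <;> simp [inequalities, h i, hm]

lemma isGDD_of_inequalities (hn : 2 ≤ n) {A : Matrix (Fin n) (Fin n) ℂ} {g h : Fin n → ℝ}
    (hg : g ∈ nearlyDominatingDiag A) (hh : h ∈ nearlyDominatingDiag A) {α β : ℝ}
    (hα : α ∈ Set.Icc (0 : ℝ) 1) (hβ : β ∈ Set.Icc (0 : ℝ) 1) (k : Fin 19)
    (H : ∀ i j, i ≠ j → inequalities (fun l => ‖A l l‖) g h α β i j k) : IsGDD A := by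
  have g0 := hg.1
  have h0 := hh.1
  have amgm : ∀ {t p q : ℝ}, t ∈ Set.Icc (0 : ℝ) 1 → 0 ≤ p → 0 ≤ q →
      p ^ t * q ^ (1 - t) ≤ t * p + (1 - t) * q := fun ht hp hq =>
    Real.geom_mean_le_arith_mean2_weighted ht.1 (sub_nonneg.2 ht.2) hp hq (by ring)
  have nn : ∀ {x y : ℝ} (s t : ℝ), 0 ≤ x → 0 ≤ y → 0 ≤ x ^ s * y ^ t := fun s t hx hy =>
    mul_nonneg (Real.rpow_nonneg hx s) (Real.rpow_nonneg hy t)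
  have geo {t : ℝ} (ht : t ∈ Set.Icc (0 : ℝ) 1) := geom_mean_mem_nearlyDominatingDiag hg hh ht
  have geo' {t : ℝ} (ht : t ∈ Set.Icc (0 : ℝ) 1) := geom_mean_mem_nearlyDominatingDiag hh hg ht
  have ari {t : ℝ} (ht : t ∈ Set.Icc (0 : ℝ) 1) := arith_mean_mem_nearlyDominatingDiag hg hh ht
  have ari' {t : ℝ} (ht : t ∈ Set.Icc (0 : ℝ) 1) := arith_mean_mem_nearlyDominatingDiag hh hg ht
  fin_cases k
  · exact isGDD_of_lt hn hg H
  · exact isGDD_of_lt hn (geo hα) H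
  · exact isGDD_of_lt hn (ari hα) H
  · exact isGDD_of_mul_lt_mul hn hg hg H
  · exact isGDD_of_mul_lt_mul hn hg hh H
  · exact isGDD_of_mul_lt_mul hn (geo hα) (geo hα) fun i j hij =>
      (mul_rpow_mul_mul_rpow (g0 i) (g0 j) (h0 i) (h0 j) α (1 - α)).symm.trans_lt (H i j hij)
  -- The second vector has g and h exchanged, which matches the crossed products.
  · refine isGDD_of_mul_lt_mul hn (geo hα) (geo' hα) fun i j hij =>
      Eq.trans_lt ?_ (H i j hij)
    rw [mul_comm (g j), mul_rpow_mul_mul_rpow (g0 i) (h0 j) (h0 i) (g0 j)]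
  -- AM-GM on the products reduces this sum to the geometric form.
  · exact isGDD_of_mul_lt_mul hn (geo hα) (geo hα) fun i j hij =>
      (mul_rpow_mul_mul_rpow (g0 i) (g0 j) (h0 i) (h0 j) α (1 - α)).symm.trans_lt
        ((amgm hα (mul_nonneg (g0 i) (g0 j)) (mul_nonneg (h0 i) (h0 j))).trans_lt (H i j hij))
  · refine isGDD_of_mul_lt_mul hn (geo hα) (geo' hα) fun i j hij => Eq.trans_lt ?_
      ((amgm hα (mul_nonneg (g0 i) (h0 j)) (mul_nonneg (g0 j) (h0 i))).trans_lt (H i j hij))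
    rw [mul_comm (g j), mul_rpow_mul_mul_rpow (g0 i) (h0 j) (h0 i) (g0 j)]
  · exact isGDD_of_mul_lt_mul hn (ari hα) (ari hα) H
  · exact isGDD_of_mul_lt_mul hn (ari hα) (ari' hα) H
  · exact isGDD_of_rpow_mul_rpow_lt hn hg hg hα H
  · exact isGDD_of_rpow_mul_rpow_lt hn hg hh hα H
  · exact isGDD_of_rpow_mul_rpow_lt hn (geo hβ) (geo hβ) hα H
  · exact isGDD_of_rpow_mul_rpow_lt hn (geo hβ) (geo' hβ) hα H
  · exact isGDD_of_rpow_mul_rpow_lt hn (geo hβ) (geo hβ) hα fun i j hij =>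
      (rpow_mul_rpow_rpow_comm (g0 i) (g0 j) (h0 i) (h0 j) α (1 - α) β (1 - β)).trans_lt
        ((amgm hβ (nn _ _ (g0 i) (g0 j)) (nn _ _ (h0 i) (h0 j))).trans_lt (H i j hij))
  · exact isGDD_of_rpow_mul_rpow_lt hn (geo hβ) (geo' hβ) hα fun i j hij =>
      (rpow_mul_rpow_rpow_comm (g0 i) (h0 j) (h0 i) (g0 j) α (1 - α) β (1 - β)).trans_lt
        ((amgm hβ (nn _ _ (g0 i) (h0 j)) (nn _ _ (h0 i) (g0 j))).trans_lt (H i j hij))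
  · exact isGDD_of_rpow_mul_rpow_lt hn (ari hβ) (ari hβ) hα H
  · exact isGDD_of_rpow_mul_rpow_lt hn (ari hβ) (ari' hβ) hα H

end GFun

theorem theorem4p1 (n : ℕ) (hn : 2 ≤ n) (A : Matrix (Fin n) (Fin n) ℂ) (k : Fin 19) :
    GFun.IsGDD A ↔
      ∃ g ∈ GFun.classG n, ∃ h ∈ GFun.classG n,
        ∃ α ∈ Set.Icc (0 : ℝ) 1, ∃ β ∈ Set.Icc (0 : ℝ) 1,
          ∀ i j : Fin n, i ≠ j →
            GFun.inequalities (fun l => ‖A l l‖) (g A) (h A) α β i j k := by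
  constructor
  · intro hA
    obtain ⟨x, hx, hlt⟩ := GFun.isGDD_iff_exists_weightedRowSum_lt.1 hA
    have hmem := GFun.weightedRowSum_mem_classG hx
    exact ⟨_, hmem, _, hmem, 1, by simp, 1, by simp, fun i j _ =>
      GFun.inequalities_self_one (GFun.weightedRowSum_nonneg hx A) hlt i j k⟩
  · rintro ⟨g, hg, h, hh, α, hα, β, hβ, H⟩
    exact GFun.isGDD_of_inequalities hn (GFun.classG_apply_mem_nearlyDominatingDiag hg A)
      (GFun.classG_apply_mem_nearlyDominatingDiag hh A) hα hβ k H
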